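/- Let $X$ be a complete separable metric space with its Borel $\sigma$-field. Let $\mathcal M(X)$ be the set of Borel measures on $X$ that are finite on bounded Borel sets (called Radon measures), and let $\mathcal M^{\cdot\cdot}(X)\subset\mathcal M(X)$ be the set of point measures, i.e. those with values in $\mathbb N\cup\{+\infty\}$ ($0\in\mathbb N$). Both carry the $\sigma$-field generated by the evaluations $\mu\mapsto\mu(B)$, $B$ Borel, and the vague topology, i.e. the coarsest topology making $\mu\mapsto\int f\,d\mu$ continuous for every bounded continuous $f:X\to\mathbb R$ with bounded support. A point process is a probability measure on $\mathcal M^{\cdot\cdot}(X)$. Let $\pi$ be a Radon kernel from $\mathcal M^{\cdot\cdot}(X)$ to $X$: $\pi(\mu,\cdot)\in\mathcal M(X)$ for each $\mu\in\mathcal M^{\cdot\cdot}(X)$, and $\mu\mapsto\pi(\mu,B)$ is measurable for each Borel set $B$. Define the iterated kernels by $\pi^{(0)}=1$ and $$\pi^{(k)}(\mu;dx_1,\dots,dx_k)=\pi(\mu+\delta_{x_1}+\dots+\delta_{x_{k-1}},dx_k)\,\pi^{(k-1)}(\mu;dx_1,\dots,dx_{k-1}),\qquad k\ge 1.$$ Assume: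 - $(\mathcal A_1)$ for all $\mu\in\mathcal M^{\cdot\cdot}(X)$, $\pi(\mu+\delta_y,dx)\,\pi(\mu,dy)=\pi(\mu+\delta_x,dy)\,\pi(\mu,dx)$ as measures on $X\times X$; - $(\mathcal A_2)$ for all $y\in X$ and $\mu\in\mathcal M^{\cdot\cdot}(X)$, the measures $\pi(\mu+\delta_y,\cdot)$ and $\pi(\mu,\cdot)$ agree on $X\setminus\{y\}$; - $(\mathcal A_3)$ for all $\mu\in\mathcal M^{\cdot\cdot}(X)$ and all bounded Borel sets $B$, with $\mu_{B^c}$ the restriction of $\mu$ to $B^c=X\setminus B$, $$0<\sum_{m=0}^\infty\frac{\pi^{(m)}(\mu_{B^c},B^m)}{m!}<\infty;$$ - $(\mathcal A_7)$ the map $\pi:\mathcal M^{\cdot\cdot}(X)\to\mathcal M(X)$ is continuous for the vague topologies. Then there exists exactly one Papangelou process with Papangelou kernel $\pi$, i.e. exactly one point process $P$ such that for every measurable $h:X\times\mathcal M^{\cdot\cdot}(X)\to[0,\infty]$ $$\iint h(x,\mu)\,\mu(dx)\,P(d\mu)=\iint h(x,\mu+\delta_x)\,\pi(\mu,dx)\,P(d\mu).$$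 -/

import Mathlib

open MeasureTheory Set
open scoped ENNReal BoundedContinuousFunction

namespace Papangelou

section Spaces

variable (X : Type*) [MetricSpace X] [MeasurableSpace X]

/-- The Borel measures on `X` that are finite on all bounded Borel sets ("Radon measures" in the
sense of point process theory), as an additive submonoid of all measures. -/
def radonMeasures : AddSubmonoid (Measure X) where
  carrier := {μ | ∀ B : Set X, MeasurableSet B → Bornology.IsBounded B → μ B < ∞}
  zero_mem' := by
    intro B _ _
    simp
  add_mem' := by
    intro μ ν hμ hν B hB hb
    rw [Measure.add_apply]
    exact ENNReal.add_lt_top.2 ⟨hμ B hB hb, hν B hB hb⟩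

/-- The space `𝓜(X)` of Radon measures. Its σ-algebra, inherited from `Measure X`, is the one
generated by the evaluations `μ ↦ μ B`, `B` Borel. -/
abbrev RadonMeasure : Type _ := radonMeasures X

/-- The vague topology: the coarsest topology for which `μ ↦ ∫ f dμ` is continuous for every
bounded continuous `f : X → ℝ` with bounded support. -/
noncomputable instance vagueTopology : TopologicalSpace (RadonMeasure X) :=
  ⨅ f : {f : X →ᵇ ℝ // Bornology.IsBounded (Function.support f)},
    TopologicalSpace.induced (fun μ : RadonMeasure X => ∫ x, f.1 x ∂μ.1) inferInstance

/-- The Radon measures with values in `ℕ ∪ {∞}`. -/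
def pointMeasures : AddSubmonoid (RadonMeasure X) where
  carrier := {μ | ∀ B : Set X, MeasurableSet B → ∃ n : ℕ∞, μ.1 B = (n : ℝ≥0∞)}
  zero_mem' := by
    intro B _
    exact ⟨0, by simp⟩
  add_mem' := by
    intro μ ν hμ hν B hB
    obtain ⟨m, hm⟩ := hμ B hB
    obtain ⟨n, hn⟩ := hν B hB
    refine ⟨m + n, ?_⟩
    have h : (μ + ν).1 B = μ.1 B + ν.1 B := rfl
    rw [h, hm, hn]
    simp

/-- The space `𝓜··(X)` of point measures, with the trace σ-algebra and the subspace (vague)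
topology of `𝓜(X)`. -/
abbrev PointMeasure : Type _ := pointMeasures X

end Spaces

variable {X : Type*} [MetricSpace X] [MeasurableSpace X]

/-- The underlying measure of a point measure. -/
abbrev PointMeasure.toMeasure (μ : PointMeasure X) : Measure X := μ.1.1

/-- The point measure `δ_x`. -/
noncomputable def PointMeasure.dirac (x : X) : PointMeasure X :=
  ⟨⟨Measure.dirac x, fun B _ _ => (measure_lt_top (Measure.dirac x) B)⟩, by
    intro B hB
    by_cases h : x ∈ B
    · exact ⟨1, by simp [Measure.dirac_apply' x hB, h]⟩
    · exact ⟨0, by simp [Measure.dirac_apply' x hB, h]⟩⟩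

/-- The restriction `μ_B` of a point measure to a Borel set `B`. -/
noncomputable def PointMeasure.restrict (μ : PointMeasure X) (B : Set X) (hB : MeasurableSet B) :
    PointMeasure X :=
  ⟨⟨μ.toMeasure.restrict B, fun A hA hb =>
      (Measure.restrict_apply_le B A).trans_lt (μ.1.2 A hA hb)⟩, by
    intro A hA
    obtain ⟨n, hn⟩ := μ.2 (A ∩ B) (hA.inter hB)
    exact ⟨n, by rw [← hn]; exact Measure.restrict_apply hA⟩⟩

/-- A Radon kernel from `𝓜··(X)` to `X`: each `π μ` is a Radon measure, and `μ ↦ π μ B` is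
measurable for each Borel set `B`. -/
structure RadonKernel (X : Type*) [MetricSpace X] [MeasurableSpace X] where
  toFun : PointMeasure X → RadonMeasure X
  measurable_apply : ∀ B : Set X, MeasurableSet B → Measurable fun μ => (toFun μ).1 B

/-- The measure `π(μ, ·)`. -/
abbrev RadonKernel.measure (π : RadonKernel X) (μ : PointMeasure X) : Measure X := (π.toFun μ).1

/-- Integration against the iterated kernel `π⁽ᵏ⁾(μ; dx₁, …, dxₖ)`, where `π⁽⁰⁾ = 1` and
`π⁽ᵏ⁺¹⁾(μ; dx₁, …, dxₖ₊₁) = π(μ + δ_{x₁} + ⋯ + δ_{xₖ}, dxₖ₊₁) π⁽ᵏ⁾(μ; dx₁, …, dxₖ)`. -/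
noncomputable def RadonKernel.iterLIntegral (π : RadonKernel X) (μ : PointMeasure X) :
    (k : ℕ) → ((Fin k → X) → ℝ≥0∞) → ℝ≥0∞
  | 0, f => f Fin.elim0
  | k + 1, f => RadonKernel.iterLIntegral π μ k fun x =>
      ∫⁻ y, f (Fin.snoc (α := fun _ => X) x y)
        ∂(π.measure (μ + ∑ i, PointMeasure.dirac (x i)))

/-- The value `π⁽ᵏ⁾(μ, A)` of the iterated kernel on `A ⊆ Xᵏ`. -/
noncomputable def RadonKernel.iter (π : RadonKernel X) (μ : PointMeasure X) (k : ℕ)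
    (A : Set (Fin k → X)) : ℝ≥0∞ :=
  π.iterLIntegral μ k (A.indicator 1)

/-- The cocycle condition: for every `μ`, the measures `π(μ + δ_y, dx) π(μ, dy)` and
`π(μ + δ_x, dy) π(μ, dx)` on `X × X` agree. -/
def RadonKernel.Cocycle (π : RadonKernel X) : Prop :=
  ∀ (μ : PointMeasure X) (h : X × X → ℝ≥0∞), Measurable h →
    ∫⁻ y, ∫⁻ x, h (x, y) ∂(π.measure (μ + PointMeasure.dirac y)) ∂(π.measure μ) =
      ∫⁻ x, ∫⁻ y, h (x, y) ∂(π.measure (μ + PointMeasure.dirac x)) ∂(π.measure μ)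

/-- The weak sufficiency postulate: `π(μ + δ_y, ·) = π(μ, ·)` on `{y}ᶜ`. -/
def RadonKernel.WeakSufficiency (π : RadonKernel X) : Prop :=
  ∀ (y : X) (μ : PointMeasure X),
    (π.measure (μ + PointMeasure.dirac y)).restrict {y}ᶜ = (π.measure μ).restrict {y}ᶜ

/-- The local integrability condition: `0 < ∑ₘ π⁽ᵐ⁾(μ_{Bᶜ}, Bᵐ) / m! < ∞` for every point measure
`μ` and every bounded Borel set `B`. -/
def RadonKernel.LocallyIntegrable (π : RadonKernel X) : Prop :=
  ∀ (μ : PointMeasure X) (B : Set X) (hB : MeasurableSet B), Bornology.IsBounded B →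
    0 < ∑' m : ℕ, π.iter (μ.restrict Bᶜ hB.compl) m (Set.univ.pi fun _ => B)
        / (m.factorial : ℝ≥0∞) ∧
      ∑' m : ℕ, π.iter (μ.restrict Bᶜ hB.compl) m (Set.univ.pi fun _ => B)
        / (m.factorial : ℝ≥0∞) < ∞

/-- Continuity of `π : 𝓜··(X) → 𝓜(X)` for the vague topologies. -/
def RadonKernel.VaguelyContinuous (π : RadonKernel X) : Prop :=
  Continuous π.toFun

/-- Integration `C_P(h) = ∬ h(x, μ) μ(dx) P(dμ)` against the Campbell measure of `P`. -/
noncomputable def campbell (P : ProbabilityMeasure (PointMeasure X))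
    (h : X × PointMeasure X → ℝ≥0∞) : ℝ≥0∞ :=
  ∫⁻ μ, ∫⁻ x, h (x, μ) ∂μ.toMeasure ∂(P : Measure (PointMeasure X))

/-- The point process `P` is a Papangelou process with Papangelou kernel `π`. -/
def IsPapangelouProcess (π : RadonKernel X) (P : ProbabilityMeasure (PointMeasure X)) : Prop :=
  ∀ h : X × PointMeasure X → ℝ≥0∞, Measurable h →
    campbell P h =
      ∫⁻ μ, ∫⁻ x, h (x, μ + PointMeasure.dirac x) ∂(π.measure μ) ∂(P : Measure (PointMeasure X))

end Papangelou

/-! The point is locality: on a bounded Borel set `B`, the measure `π(μ, ·)` depends only on `μ_B`.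
The weak sufficiency postulate, applied point by point, says that finitely many points outside `B`
do not matter; infinitely many are handled by vague continuity, since the restrictions of `μ` to
growing bounded open sets converge vaguely to `μ` (`restrict_measure_restrict`).

Let `Z_B` (`localMeasure`) be the sum over `m` of `1/m!` times the image of `π⁽ᵐ⁾(0; ·)` on `Bᵐ`
under `(x₁, …, xₘ) ↦ δ_{x₁} + ⋯ + δ_{xₘ}`. The cocycle condition makes the order of the points
irrelevant, so `Z_B` satisfies the Papangelou identity in `B` (`campbell_localMeasure`), and local
integrability makes it finite.

Uniqueness: for a Papangelou process, the identity removes points of `B` one at a time. By locality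
this shows that the law of `μ_B` is `P(μ(B) = 0) • Z_B`, and total mass one fixes the constant
(`IsPapangelouProcess.map_restrict`). The laws in an exhausting sequence of bounded sets determine
`P`.

Existence: cut `X` into disjoint bounded cells, draw independent configurations from the normalised
local laws, and glue them. By locality each cell satisfies its own identity whatever lies outside
it, and summing over the cells gives the full identity. -/

namespace Papangelou

open ProbabilityTheory Filter Topology

/-! ### S-finiteness of kernels without uniform bounds -/

section Kernels

variable {Ω X : Type*} [MeasurableSpace Ω] [MeasurableSpace X]

/-- A kernel all of whose measures are finite is s-finite, even without a uniform bound. -/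
theorem isSFiniteKernel_of_forall_isFiniteMeasure (κ : Kernel Ω X)
    (hκ : ∀ a, κ a univ < ∞) : IsSFiniteKernel κ := by
  classical
  -- Slice the parameter space by total mass: on the `j`-th slice the kernel is bounded by `j`.
  let S : ℕ → Set Ω := disjointed fun j => {a | κ a univ ≤ j}
  have hS0 : ∀ j : ℕ, MeasurableSet {a | κ a univ ≤ (j : ℝ≥0∞)} := fun j =>
    measurableSet_le (κ.measurable_coe MeasurableSet.univ) measurable_const
  have hS : ∀ j, MeasurableSet (S j) := fun j => MeasurableSet.disjointed hS0 j
  have hcov : ∀ a, ∃ j, a ∈ S j := by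
    intro a
    obtain ⟨j, hj⟩ := ENNReal.exists_nat_gt (hκ a).ne
    have : a ∈ ⋃ j, S j := by
      rw [iUnion_disjointed]
      exact mem_iUnion.2 ⟨j, hj.le⟩
    exact mem_iUnion.1 this
  have hsum : κ = Kernel.sum fun j => Kernel.piecewise (hS j) κ 0 := by
    ext a s hs
    rw [Kernel.sum_apply' _ _ hs]
    obtain ⟨j, hj⟩ := hcov a
    rw [tsum_eq_single j]
    · simp [Kernel.piecewise_apply, hj]
    · intro i hi
      have : a ∉ S i := fun h =>
        (disjoint_disjointed (fun j : ℕ => {a | κ a univ ≤ (j : ℝ≥0∞)}) hi).le_bot ⟨h, hj⟩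
      simp [Kernel.piecewise_apply, this]
  rw [hsum]
  refine Kernel.isSFiniteKernel_sum (hκs := fun j => ?_)
  have : IsFiniteKernel (Kernel.piecewise (hS j) κ 0) := by
    refine ⟨⟨j, ENNReal.natCast_lt_top j, fun a => ?_⟩⟩
    by_cases h : a ∈ S j
    · simpa [Kernel.piecewise_apply, h] using disjointed_subset _ _ h
    · simp [Kernel.piecewise_apply, h]
  infer_instance

/-- A kernel whose measures are all finite on the members of a countable cover is s-finite. -/
theorem isSFiniteKernel_of_iUnion_eq_univ (κ : Kernel Ω X) (U : ℕ → Set X)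
    (hU : ∀ n, MeasurableSet (U n)) (hcov : ⋃ n, U n = univ) (hκ : ∀ a n, κ a (U n) < ∞) :
    IsSFiniteKernel κ := by
  have hD : ∀ n, MeasurableSet (disjointed U n) := fun n => MeasurableSet.disjointed hU n
  have hsum : κ = Kernel.sum fun n => κ.restrict (hD n) := by
    ext a s hs
    rw [Kernel.sum_apply' _ _ hs]
    simp_rw [Kernel.restrict_apply, Measure.restrict_apply hs]
    rw [← measure_iUnion, ← inter_iUnion, iUnion_disjointed, hcov, inter_univ]
    · exact fun i j hij => (disjoint_disjointed U hij).mono inter_subset_right inter_subset_right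
    · exact fun n => hs.inter (hD n)
  rw [hsum]
  refine Kernel.isSFiniteKernel_sum
    (hκs := fun n => isSFiniteKernel_of_forall_isFiniteMeasure _ fun a => ?_)
  rw [Kernel.restrict_apply, Measure.restrict_apply_univ]
  exact (measure_mono (disjointed_subset U n)).trans_lt (hκ a n)

end Kernels

/-- Every metric space is exhausted by a sequence of bounded open sets. -/
theorem exists_bounded_exhaustion (X : Type*) [MetricSpace X] :
    ∃ U : ℕ → Set X, (∀ n, IsOpen (U n)) ∧ (∀ n, Bornology.IsBounded (U n)) ∧ Monotone U ∧
      (⋃ n, U n = univ) ∧ ∀ B, Bornology.IsBounded B → ∃ n, B ⊆ U n := by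
  rcases isEmpty_or_nonempty X with h | ⟨⟨x⟩⟩
  · exact ⟨fun _ => univ, fun _ => isOpen_univ, fun _ => (toFinite _).isBounded,
      monotone_const, iUnion_const _, fun B _ => ⟨0, subset_univ B⟩⟩
  · refine ⟨fun n => Metric.ball x n, fun n => Metric.isOpen_ball,
      fun n => Metric.isBounded_ball, fun m n h => Metric.ball_subset_ball (by exact_mod_cast h),
      Metric.iUnion_ball_nat x, fun B hB => ?_⟩
    obtain ⟨r, hr⟩ := hB.subset_ball x
    obtain ⟨n, hn⟩ := exists_nat_ge r
    exact ⟨n, hr.trans (Metric.ball_subset_ball hn)⟩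

variable {X : Type*} [MetricSpace X] [MeasurableSpace X]

/-! ### Point measures: restriction, measurability, atoms -/

namespace PointMeasure

@[ext]
theorem ext {μ ν : PointMeasure X} (h : ∀ B, MeasurableSet B → μ.toMeasure B = ν.toMeasure B) :
    μ = ν :=
  Subtype.ext (Subtype.ext (Measure.ext h))

theorem toMeasure_add (μ ν : PointMeasure X) : (μ + ν).toMeasure = μ.toMeasure + ν.toMeasure := rfl

theorem toMeasure_zero : (0 : PointMeasure X).toMeasure = 0 := rfl

theorem toMeasure_dirac (x : X) : (dirac x).toMeasure = Measure.dirac x := rfl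

theorem toMeasure_restrict (μ : PointMeasure X) {B : Set X} (hB : MeasurableSet B) :
    (μ.restrict B hB).toMeasure = μ.toMeasure.restrict B := rfl

theorem restrict_apply (μ : PointMeasure X) {B A : Set X} (hB : MeasurableSet B)
    (hA : MeasurableSet A) : (μ.restrict B hB).toMeasure A = μ.toMeasure (A ∩ B) := by
  rw [toMeasure_restrict, Measure.restrict_apply hA]

theorem restrict_add (μ ν : PointMeasure X) {B : Set X} (hB : MeasurableSet B) :
    (μ + ν).restrict B hB = μ.restrict B hB + ν.restrict B hB := by
  ext A hA
  rw [restrict_apply _ hB hA, toMeasure_add, toMeasure_add, Measure.add_apply, Measure.add_apply,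
    restrict_apply _ hB hA, restrict_apply _ hB hA]

theorem restrict_zero {B : Set X} (hB : MeasurableSet B) :
    (0 : PointMeasure X).restrict B hB = 0 := by
  ext A hA
  simp [restrict_apply _ hB hA, toMeasure_zero]

theorem restrict_dirac_of_mem {x : X} {B : Set X} (hB : MeasurableSet B) (hx : x ∈ B) :
    (dirac x).restrict B hB = dirac x := by
  ext A hA
  rw [restrict_apply _ hB hA, toMeasure_dirac, Measure.dirac_apply' _ (hA.inter hB),
    Measure.dirac_apply' _ hA]
  by_cases h : x ∈ A <;> simp [h, hx]

theorem restrict_restrict (μ : PointMeasure X) {A B : Set X} (hA : MeasurableSet A)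
    (hB : MeasurableSet B) :
    (μ.restrict A hA).restrict B hB = μ.restrict (B ∩ A) (hB.inter hA) := by
  ext C hC
  rw [restrict_apply _ hB hC, restrict_apply _ hA (hC.inter hB), restrict_apply _ _ hC, inter_assoc]

theorem restrict_add_restrict_diff (μ : PointMeasure X) {A B : Set X} (hA : MeasurableSet A)
    (hB : MeasurableSet B) (hAB : A ⊆ B) :
    μ.restrict B hB = μ.restrict A hA + μ.restrict (B \ A) (hB.diff hA) := by
  ext C hC
  rw [toMeasure_add, Measure.add_apply, restrict_apply _ _ hC, restrict_apply _ _ hC,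
    restrict_apply _ _ hC, ← measure_inter_add_sdiff (C ∩ B) hA]
  congr 2
  · rw [inter_assoc, inter_eq_self_of_subset_right hAB]
  · rw [inter_sdiff_assoc]

theorem restrict_add_restrict_compl (μ : PointMeasure X) {A : Set X} (hA : MeasurableSet A) :
    μ = μ.restrict A hA + μ.restrict Aᶜ hA.compl := by
  ext C hC
  rw [toMeasure_add, Measure.add_apply, restrict_apply _ _ hC, restrict_apply _ _ hC,
    ← sdiff_eq, measure_inter_add_sdiff _ hA]

theorem exists_nat_eq (μ : PointMeasure X) {B : Set X} (hB : MeasurableSet B)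
    (h : μ.toMeasure B ≠ ∞) : ∃ n : ℕ, μ.toMeasure B = n := by
  obtain ⟨n, hn⟩ := μ.2 B hB
  have hn' : μ.toMeasure B = (n : ℝ≥0∞) := hn
  induction n using ENat.recTopCoe with
  | top => simp [hn'] at h
  | coe n => exact ⟨n, by simpa using hn'⟩

theorem measurable_toMeasure : Measurable (toMeasure : PointMeasure X → Measure X) :=
  measurable_subtype_coe.comp measurable_subtype_coe

theorem measurable_toMeasure_apply {B : Set X} (hB : MeasurableSet B) :
    Measurable fun μ : PointMeasure X => μ.toMeasure B :=
  (Measure.measurable_coe hB).comp measurable_toMeasure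

theorem measurable_of_forall {Ω : Type*} [MeasurableSpace Ω] {f : Ω → PointMeasure X}
    (h : ∀ B, MeasurableSet B → Measurable fun ω => (f ω).toMeasure B) : Measurable f :=
  Measurable.subtype_mk (Measurable.subtype_mk (Measure.measurable_of_measurable_coe _ h))

theorem measurable_restrict {B : Set X} (hB : MeasurableSet B) :
    Measurable fun μ : PointMeasure X => μ.restrict B hB := by
  refine measurable_of_forall fun A hA => ?_
  simp_rw [restrict_apply _ hB hA]
  exact measurable_toMeasure_apply (hA.inter hB)

theorem measurable_dirac : Measurable (dirac : X → PointMeasure X) := by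
  refine measurable_of_forall fun A hA => ?_
  simp_rw [toMeasure_dirac, Measure.dirac_apply' _ hA]
  exact measurable_one.indicator hA

theorem measurable_add : Measurable fun p : PointMeasure X × PointMeasure X => p.1 + p.2 := by
  refine measurable_of_forall fun A hA => ?_
  simp_rw [toMeasure_add, Measure.add_apply]
  exact ((measurable_toMeasure_apply hA).comp measurable_fst).add
    ((measurable_toMeasure_apply hA).comp measurable_snd)

instance : MeasurableAdd₂ (PointMeasure X) := ⟨measurable_add⟩

/-- A nonzero finite point measure has an atom. -/
theorem exists_atom [SecondCountableTopology X] [BorelSpace X] (ν : PointMeasure X)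
    (hfin : ν.toMeasure univ ≠ ∞) (h0 : ν ≠ 0) : ∃ x, ν.toMeasure {x} ≠ 0 := by
  have hne : ν.toMeasure ≠ 0 := fun h => h0 (Subtype.ext (Subtype.ext h))
  obtain ⟨x, hx⟩ := Measure.nonempty_support hne
  refine ⟨x, fun hzero => ?_⟩
  rw [Measure.mem_support_iff_forall] at hx
  have : IsFiniteMeasure ν.toMeasure := ⟨hfin.lt_top⟩
  -- Balls around a support point shrink to `{x}`. Were `{x}` null, some ball would have mass
  -- strictly between 0 and 1, which an integer-valued measure forbids.
  have hlim : Tendsto (fun n : ℕ => ν.toMeasure (Metric.closedBall x (1 / ((n : ℝ) + 1)))) atTop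
      (𝓝 (ν.toMeasure (⋂ n : ℕ, Metric.closedBall x (1 / ((n : ℝ) + 1))))) := by
    refine tendsto_measure_iInter_atTop
      (fun n => Metric.isClosed_closedBall.measurableSet.nullMeasurableSet) ?_
      ⟨0, measure_ne_top _ _⟩
    intro m n hmn
    exact Metric.closedBall_subset_closedBall
      (one_div_le_one_div_of_le (by positivity) (by gcongr))
  have hinter : (⋂ n : ℕ, Metric.closedBall x (1 / ((n : ℝ) + 1))) = {x} := by
    refine Subset.antisymm (fun y hy => ?_) ?_
    · rw [mem_singleton_iff, ← dist_le_zero]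
      exact ge_of_tendsto' tendsto_one_div_add_atTop_nhds_zero_nat fun n => mem_iInter.1 hy n
    · rintro _ rfl
      exact mem_iInter.2 fun n => Metric.mem_closedBall_self (by positivity)
  rw [hinter, hzero] at hlim
  obtain ⟨n, hn⟩ := (hlim.eventually (gt_mem_nhds one_pos)).exists
  have hpos := hx _ (Metric.closedBall_mem_nhds x (Nat.one_div_pos_of_nat (n := n) (α := ℝ)))
  obtain ⟨k, hk⟩ := ν.exists_nat_eq
    (Metric.isClosed_closedBall (x := x) (ε := 1 / ((n : ℝ) + 1))).measurableSet
    (measure_ne_top _ _)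
  rw [hk] at hn hpos
  have h1 : k < 1 := by exact_mod_cast hn
  have h2 : 0 < k := by exact_mod_cast hpos
  omega

theorem nsmul_toMeasure_apply (k : ℕ) (μ : PointMeasure X) (B : Set X) :
    (k • μ).toMeasure B = k * μ.toMeasure B := by
  induction k with
  | zero => simp [toMeasure_zero]
  | succ k ih => rw [succ_nsmul, toMeasure_add, Measure.add_apply, ih]; push_cast; ring

end PointMeasure

open PointMeasure

/-! ### Locality of the kernel -/

namespace RadonKernel

variable (π : RadonKernel X)

/-- The kernel `π` as a kernel in the sense of measure theory. -/
noncomputable def kernel : Kernel (PointMeasure X) X where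
  toFun := π.measure
  measurable' := Measure.measurable_of_measurable_coe _ π.measurable_apply

variable {π}

/-- Adding finitely many points outside `B` does not change `π(μ, ·)` on `B`. -/
theorem restrict_add_of_null [SecondCountableTopology X] [BorelSpace X]
    (hA2 : π.WeakSufficiency) {B : Set X} (hB : MeasurableSet B) (μ ν : PointMeasure X)
    (hfin : ν.toMeasure univ ≠ ∞) (hnull : ν.toMeasure B = 0) :
    (π.measure (μ + ν)).restrict B = (π.measure μ).restrict B := by
  obtain ⟨n, hn⟩ := ν.exists_nat_eq MeasurableSet.univ hfin
  -- Induction on the total mass of `ν`: each step strips one atom with its whole multiplicity `k`.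
  -- The atom lies outside `B` because `B` is `ν`-null.
  induction n using Nat.strong_induction_on generalizing ν with
  | _ n ih =>
  by_cases h0 : ν = 0
  · rw [h0, add_zero]
  obtain ⟨x, hx⟩ := ν.exists_atom hfin h0
  have hxs : MeasurableSet ({x} : Set X) := measurableSet_singleton x
  have hxB : B ⊆ {x}ᶜ := by
    intro y hy hyx
    rw [mem_singleton_iff] at hyx
    subst hyx
    exact hx (measure_mono_null (singleton_subset_iff.2 hy) hnull)
  obtain ⟨k, hk⟩ := ν.exists_nat_eq hxs
    (ne_top_of_le_ne_top hfin (measure_mono (subset_univ _)))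
  obtain ⟨m, hm⟩ := ν.exists_nat_eq hxs.compl
    (ne_top_of_le_ne_top hfin (measure_mono (subset_univ _)))
  have hatom : ν.restrict {x} hxs = k • dirac x := by
    ext A hA
    rw [PointMeasure.restrict_apply _ _ hA, nsmul_toMeasure_apply, toMeasure_dirac, Measure.dirac_apply' _ hA]
    by_cases hxA : x ∈ A
    · rw [inter_eq_self_of_subset_right (singleton_subset_iff.2 hxA), hk]
      simp [hxA]
    · rw [inter_singleton_eq_empty.2 hxA]
      simp [hxA]
  have hdir : ∀ (j : ℕ) (μ' : PointMeasure X),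
      (π.measure (μ' + j • dirac x)).restrict B = (π.measure μ').restrict B := by
    intro j
    induction j with
    | zero => simp
    | succ j ihj =>
      intro μ'
      rw [succ_nsmul, ← add_assoc, ← ihj μ']
      have := congrArg (fun m => m.restrict B) (hA2 x (μ' + j • dirac x))
      simpa only [Measure.restrict_restrict hB, inter_eq_self_of_subset_left hxB] using this
  have hsplit := ν.restrict_add_restrict_compl hxs
  rw [hatom] at hsplit
  have hadd : (n : ℝ≥0∞) = k + m := by
    rw [← hn, ← hk, ← hm, measure_add_measure_compl hxs]
  rw [hsplit, add_comm (k • dirac x), ← add_assoc, hdir]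
  have huniv : (ν.restrict {x}ᶜ hxs.compl).toMeasure univ = m := by
    rw [PointMeasure.restrict_apply _ _ MeasurableSet.univ, univ_inter, hm]
  refine ih m ?_ _ (by rw [huniv]; exact ENNReal.natCast_ne_top m) ?_ huniv
  · have h1 : n = k + m := by exact_mod_cast hadd
    have h2 : k ≠ 0 := by
      rintro rfl
      simp [hk] at hx
    omega
  · rw [PointMeasure.restrict_apply _ _ hB]
    exact measure_mono_null inter_subset_left hnull

end RadonKernel

theorem RadonMeasure.continuous_integral (f : X →ᵇ ℝ)
    (hf : Bornology.IsBounded (Function.support f)) :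
    Continuous fun μ : RadonMeasure X => ∫ x, f x ∂μ.1 :=
  continuous_iInf_dom (i := (⟨f, hf⟩ : {f : X →ᵇ ℝ // Bornology.IsBounded (Function.support f)}))
    continuous_induced_dom

theorem RadonMeasure.tendsto_of_forall {ι : Type*} {l : Filter ι} {μs : ι → RadonMeasure X}
    {μ : RadonMeasure X}
    (h : ∀ f : X →ᵇ ℝ, Bornology.IsBounded (Function.support f) →
      Tendsto (fun i => ∫ x, f x ∂(μs i).1) l (𝓝 (∫ x, f x ∂μ.1))) :
    Tendsto μs l (𝓝 μ) := by
  rw [vagueTopology, nhds_iInf, tendsto_iInf]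
  intro f
  rw [nhds_induced, tendsto_comap_iff]
  exact h f.1 f.2

/-- The restrictions of a point measure to an exhaustion converge vaguely. -/
theorem PointMeasure.tendsto_restrict [BorelSpace X] (μ : PointMeasure X) {U : ℕ → Set X}
    (hUm : ∀ n, MeasurableSet (U n)) (hmono : Monotone U)
    (hex : ∀ B, Bornology.IsBounded B → ∃ n, B ⊆ U n) :
    Tendsto (fun n => μ.restrict (U n) (hUm n)) atTop (𝓝 μ) := by
  rw [tendsto_subtype_rng]
  refine RadonMeasure.tendsto_of_forall fun f hf => ?_
  obtain ⟨M, hM⟩ := hex _ hf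
  refine tendsto_const_nhds.congr' ?_
  filter_upwards [eventually_ge_atTop M] with n hn
  refine (setIntegral_eq_integral_of_forall_compl_eq_zero fun x hx => ?_).symm
  by_contra hne
  exact hx (hmono hn (hM hne))

/-- Two measures that are finite on an open set `U` agree on `U` if they integrate all bounded
continuous functions vanishing outside `U` alike. -/
theorem restrict_eq_of_forall_integral_eq [BorelSpace X] {μ ν : Measure X} {U : Set X}
    (hU : IsOpen U) (hμ : μ U < ∞) (hν : ν U < ∞)
    (h : ∀ f : X →ᵇ ℝ, Function.support f ⊆ U → ∫ x, f x ∂μ = ∫ x, f x ∂ν) :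
    μ.restrict U = ν.restrict U := by
  have : IsFiniteMeasure (μ.restrict U) := ⟨by simpa using hμ⟩
  have : IsFiniteMeasure (ν.restrict U) := ⟨by simpa using hν⟩
  refine ext_of_forall_integral_eq_of_IsFiniteMeasure fun f => ?_
  have hF : IsClosed Uᶜ := hU.isClosed_compl
  -- `apprSeq` is 1 on the closed set `Uᶜ` and tends to 0 on `U`. Hence `g n` vanishes off `U`,
  -- tends to `f` on `U`, and is dominated by `‖f‖`.
  let g : ℕ → X →ᵇ ℝ := fun n => BoundedContinuousFunction.ofNormedAddCommGroup
    (fun x => f x * (1 - (hF.apprSeq n x : ℝ))) (by fun_prop) ‖f‖ (fun x => by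
      have h1 : ((hF.apprSeq n x : NNReal) : ℝ) ≤ 1 := by
        exact_mod_cast HasOuterApproxClosed.apprSeq_apply_le_one hF n x
      have h0 : 0 ≤ ((hF.apprSeq n x : NNReal) : ℝ) := NNReal.coe_nonneg _
      rw [norm_mul]
      refine (mul_le_of_le_one_right (norm_nonneg _) ?_).trans (f.norm_coe_le_norm x)
      rw [Real.norm_eq_abs, abs_le]
      constructor <;> linarith)
  have hg : ∀ n x, g n x = f x * (1 - (hF.apprSeq n x : ℝ)) := fun n x => rfl
  have hsupp : ∀ n, Function.support (g n) ⊆ U := by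
    intro n x hx
    by_contra hxU
    refine hx ?_
    rw [hg, HasOuterApproxClosed.apprSeq_apply_eq_one hF n hxU]
    simp
  have hlim : ∀ x ∈ U, Tendsto (fun n => g n x) atTop (𝓝 (f x)) := by
    intro x hx
    have h1 := tendsto_pi_nhds.1 (HasOuterApproxClosed.tendsto_apprSeq hF) x
    rw [indicator_of_notMem (by simpa using hx)] at h1
    have h2 : Tendsto (fun n => (hF.apprSeq n x : ℝ)) atTop (𝓝 ((0 : NNReal) : ℝ)) :=
      NNReal.tendsto_coe.2 h1
    simpa [hg] using (h2.const_sub 1).const_mul (f x)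
  have hconv : ∀ ρ : Measure X, ρ U < ∞ →
      Tendsto (fun n => ∫ x, g n x ∂ρ) atTop (𝓝 (∫ x in U, f x ∂ρ)) := by
    intro ρ hρ
    have : IsFiniteMeasure (ρ.restrict U) := ⟨by simpa using hρ⟩
    have heq : ∀ n, ∫ x, g n x ∂ρ = ∫ x in U, g n x ∂ρ := fun n =>
      (setIntegral_eq_integral_of_forall_compl_eq_zero fun x hx => by
        by_contra hne
        exact hx (hsupp n hne)).symm
    simp_rw [heq]
    refine tendsto_integral_of_dominated_convergence (fun _ => ‖f‖)
      (fun n => (g n).continuous.aestronglyMeasurable) (integrable_const _)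
      (fun n => ae_of_all _ fun x => ?_) ?_
    · exact ((g n).norm_coe_le_norm x).trans
        (BoundedContinuousFunction.norm_ofNormedAddCommGroup_le _ (norm_nonneg _) _)
    · exact (ae_restrict_mem hU.measurableSet).mono fun x hx => hlim x hx
  refine tendsto_nhds_unique (hconv μ hμ) ?_
  simp_rw [fun n => h (g n) (hsupp n)]
  exact hconv ν hν

namespace RadonKernel

variable {π : RadonKernel X}

/-- Under the weak sufficiency postulate and vague continuity, `π(μ, ·)` on a bounded set `B`
depends on `μ` only through its restriction to `B`. -/
theorem restrict_measure_restrict [SecondCountableTopology X] [BorelSpace X]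
    (hA2 : π.WeakSufficiency) (hA7 : π.VaguelyContinuous) (μ : PointMeasure X) {B : Set X}
    (hB : MeasurableSet B) (hBb : Bornology.IsBounded B) :
    (π.measure (μ.restrict B hB)).restrict B = (π.measure μ).restrict B := by
  obtain ⟨U, hUo, hUb, hmono, -, hex⟩ := exists_bounded_exhaustion X
  have hUm : ∀ n, MeasurableSet (U n) := fun n => (hUo n).measurableSet
  obtain ⟨N, hN⟩ := hex B hBb
  -- Passing from `μ_A` to `μ_{U n}` adds finitely many points, all outside `A`.
  have hstep : ∀ (n : ℕ) {A : Set X} (hA : MeasurableSet A), A ⊆ U n →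
      (π.measure (μ.restrict (U n) (hUm n))).restrict A =
        (π.measure (μ.restrict A hA)).restrict A := by
    intro n A hA hAU
    rw [μ.restrict_add_restrict_diff hA (hUm n) hAU]
    refine restrict_add_of_null hA2 hA _ _ ?_ ?_
    · rw [PointMeasure.restrict_apply _ _ MeasurableSet.univ, univ_inter]
      exact ((measure_mono sdiff_subset).trans_lt (μ.1.2 _ (hUm n) (hUb n))).ne
    · rw [PointMeasure.restrict_apply _ _ hA, inter_sdiff_self, measure_empty]
  -- The limit is taken on the open set `U N ⊇ B`, where continuous test functions determine a
  -- measure. By `hstep` the integrals are constant for `n ≥ N`, so their limit is the value at `N`.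
  have hlim : (π.measure (μ.restrict (U N) (hUm N))).restrict (U N) =
      (π.measure μ).restrict (U N) := by
    refine restrict_eq_of_forall_integral_eq (hUo N) ((π.toFun _).2 _ (hUm N) (hUb N))
      ((π.toFun _).2 _ (hUm N) (hUb N)) fun f hf => ?_
    have h1 := ((RadonMeasure.continuous_integral f ((hUb N).subset hf)).comp hA7).tendsto μ |>.comp
      (μ.tendsto_restrict hUm hmono hex)
    refine tendsto_nhds_unique (tendsto_const_nhds.congr' ?_) h1
    filter_upwards [eventually_ge_atTop N] with n hn
    have hint : ∀ ρ : Measure X, ∫ x in U N, f x ∂ρ = ∫ x, f x ∂ρ := fun ρ =>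
      setIntegral_eq_integral_of_forall_compl_eq_zero fun x hx => by
        by_contra hne
        exact hx (hf hne)
    simp only [Function.comp_apply]
    rw [← hint, ← hint (π.toFun _).1]
    change ∫ x in U N, f x ∂(π.measure _) = ∫ x in U N, f x ∂(π.measure _)
    rw [hstep n (hUm N) (hmono hn)]
  have h2 := congrArg (fun m => m.restrict B) hlim
  simp only [Measure.restrict_restrict hB, inter_eq_self_of_subset_left hN] at h2
  rw [← h2, hstep N hB hN]

end RadonKernel

/-! ### Iterated kernels on configurations and the local law -/

/-- The tautological kernel `μ ↦ μ`. -/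
noncomputable def PointMeasure.kernel (X : Type*) [MetricSpace X] [MeasurableSpace X] :
    Kernel (PointMeasure X) X where
  toFun := toMeasure
  measurable' := measurable_toMeasure

theorem isSFiniteKernel_of_forall_mem_radonMeasures [BorelSpace X] {Ω : Type*} [MeasurableSpace Ω]
    (κ : Kernel Ω X) (h : ∀ a, κ a ∈ radonMeasures X) : IsSFiniteKernel κ := by
  obtain ⟨U, hUo, hUb, -, hcov, -⟩ := exists_bounded_exhaustion X
  exact isSFiniteKernel_of_iUnion_eq_univ κ U (fun n => (hUo n).measurableSet) hcov
    fun a n => h a _ (hUo n).measurableSet (hUb n)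

instance [BorelSpace X] : IsSFiniteKernel (PointMeasure.kernel X) :=
  isSFiniteKernel_of_forall_mem_radonMeasures _ fun μ => μ.1.2

instance [BorelSpace X] (π : RadonKernel X) : IsSFiniteKernel π.kernel :=
  isSFiniteKernel_of_forall_mem_radonMeasures _ fun μ => (π.toFun μ).2

instance [BorelSpace X] (μ : PointMeasure X) : SFinite μ.toMeasure :=
  inferInstanceAs (SFinite (PointMeasure.kernel X μ))

namespace RadonKernel

variable (π : RadonKernel X)

instance [BorelSpace X] (μ : PointMeasure X) : SFinite (π.measure μ) :=
  inferInstanceAs (SFinite (π.kernel μ))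

theorem measurable_setLIntegral [BorelSpace X] {B : Set X} (hB : MeasurableSet B) {Ω : Type*}
    [MeasurableSpace Ω] {f : Ω × PointMeasure X → X → ℝ≥0∞} (hf : Measurable (Function.uncurry f)) :
    Measurable fun p : Ω × PointMeasure X => ∫⁻ x in B, f p x ∂π.measure p.2 :=
  hf.lintegral_kernel_prod_right' (κ := Kernel.prodMkLeft Ω (π.kernel.restrict hB))

theorem measurable_setLIntegral' [BorelSpace X] {B : Set X} (hB : MeasurableSet B)
    {f : PointMeasure X → X → ℝ≥0∞} (hf : Measurable (Function.uncurry f)) :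
    Measurable fun μ : PointMeasure X => ∫⁻ x in B, f μ x ∂π.measure μ :=
  hf.lintegral_kernel_prod_right' (κ := π.kernel.restrict hB)

/-- The image of the iterated kernel `π⁽ᵐ⁾(0; dx₁, …, dxₘ)`, restricted to `Bᵐ`, under
`(x₁, …, xₘ) ↦ δ_{x₁} + ⋯ + δ_{xₘ}`. -/
noncomputable def configMeasure {B : Set X} (hB : MeasurableSet B) : ℕ → Measure (PointMeasure X)
  | 0 => Measure.dirac 0
  | m + 1 => (configMeasure hB m ⊗ₘ π.kernel.restrict hB).map fun p => p.1 + dirac p.2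

variable {B : Set X} (hB : MeasurableSet B)

instance (m : ℕ) : SFinite (π.configMeasure hB m) := by
  induction m with
  | zero => exact inferInstanceAs (SFinite (Measure.dirac (0 : PointMeasure X)))
  | succ m ih =>
    exact inferInstanceAs (SFinite (Measure.map _ (π.configMeasure hB m ⊗ₘ π.kernel.restrict hB)))

theorem _root_.Papangelou.PointMeasure.measurable_add_dirac :
    Measurable fun p : PointMeasure X × X => p.1 + dirac p.2 :=
  measurable_fst.add (measurable_dirac.comp measurable_snd)

theorem lintegral_configMeasure_zero {F : PointMeasure X → ℝ≥0∞} (hF : Measurable F) :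
    ∫⁻ ν, F ν ∂π.configMeasure hB 0 = F 0 :=
  lintegral_dirac' _ hF

theorem lintegral_configMeasure_succ [BorelSpace X] {F : PointMeasure X → ℝ≥0∞}
    (hF : Measurable F) (m : ℕ) :
    ∫⁻ ν, F ν ∂π.configMeasure hB (m + 1) =
      ∫⁻ ν, ∫⁻ x in B, F (ν + dirac x) ∂π.measure ν ∂π.configMeasure hB m := by
  rw [configMeasure, lintegral_map hF measurable_add_dirac,
    Measure.lintegral_compProd (f := fun p => F (p.1 + dirac p.2))
      (hF.comp measurable_add_dirac)]
  rfl

variable {π}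

/-- Apply the cocycle condition to `h` extended by zero off `B ×ˢ B`; the indicator factorises, and
either factor can be pulled out of the inner integral. -/
theorem Cocycle.setLIntegral (hA1 : π.Cocycle) {B : Set X} (hB : MeasurableSet B) (μ : PointMeasure X) {h : X × X → ℝ≥0∞}
    (hh : Measurable h) :
    ∫⁻ y in B, ∫⁻ x in B, h (x, y) ∂π.measure (μ + dirac y) ∂π.measure μ =
      ∫⁻ x in B, ∫⁻ y in B, h (x, y) ∂π.measure (μ + dirac x) ∂π.measure μ := by
  have key := hA1 μ ((B ×ˢ B).indicator h) (hh.indicator (hB.prod hB))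
  have h1 : ∀ x y, (B ×ˢ B).indicator h (x, y) =
      B.indicator (fun x => B.indicator (fun y => h (x, y)) y) x := by
    intro x y
    by_cases hx : x ∈ B <;> by_cases hy : y ∈ B <;> simp [hx, hy, indicator]
  have h2 : ∀ x y, (B ×ˢ B).indicator h (x, y) =
      B.indicator (fun y => B.indicator (fun x => h (x, y)) x) y := by
    intro x y
    by_cases hx : x ∈ B <;> by_cases hy : y ∈ B <;> simp [hx, hy, indicator]
  have h3 : ∀ (ρ : Measure X) (y : X), ∫⁻ x, (B ×ˢ B).indicator h (x, y) ∂ρ =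
      B.indicator (fun y => ∫⁻ x in B, h (x, y) ∂ρ) y := by
    intro ρ y
    simp_rw [h2]
    by_cases hy : y ∈ B
    · simp_rw [indicator_of_mem hy]
      exact lintegral_indicator hB _
    · simp [indicator_of_notMem hy]
  have h4 : ∀ (ρ : Measure X) (x : X), ∫⁻ y, (B ×ˢ B).indicator h (x, y) ∂ρ =
      B.indicator (fun x => ∫⁻ y in B, h (x, y) ∂ρ) x := by
    intro ρ x
    simp_rw [h1]
    by_cases hx : x ∈ B
    · simp_rw [indicator_of_mem hx]
      exact lintegral_indicator hB _
    · simp [indicator_of_notMem hx]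
  simp_rw [h3, h4] at key
  rw [← lintegral_indicator hB, ← lintegral_indicator hB]
  refine Eq.trans (lintegral_congr fun y => ?_) (key.trans (lintegral_congr fun x => ?_))
  · by_cases hy : y ∈ B
    · rw [indicator_of_mem hy, indicator_of_mem hy]
    · rw [indicator_of_notMem hy, indicator_of_notMem hy]
  · by_cases hx : x ∈ B
    · rw [indicator_of_mem hx, indicator_of_mem hx]
    · rw [indicator_of_notMem hx, indicator_of_notMem hx]

/-- Write the configuration as `ν + δ_y` with `y` the last point. The marked point `x` is either
`y`, which gives the right-hand integral once, or a point of `ν`. The latter is a Campbell integral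
with one point fewer and with `g` averaged over `y`; by induction and the cocycle condition it
contributes `m` further copies. -/
theorem campbell_configMeasure_succ [BorelSpace X] (hA1 : π.Cocycle) (m : ℕ)
    {g : X × PointMeasure X → ℝ≥0∞} (hg : Measurable g) :
    ∫⁻ ν, ∫⁻ x in B, g (x, ν) ∂ν.toMeasure ∂π.configMeasure hB (m + 1) =
      (m + 1) * ∫⁻ ν, ∫⁻ x in B, g (x, ν + dirac x) ∂π.measure ν ∂π.configMeasure hB m := by
  have hcam : ∀ {g : X × PointMeasure X → ℝ≥0∞}, Measurable g →
      Measurable fun ν : PointMeasure X => ∫⁻ x in B, g (x, ν) ∂ν.toMeasure := fun hg =>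
    Measurable.lintegral_kernel_prod_right' (κ := (PointMeasure.kernel X).restrict hB)
      (hg.comp measurable_swap)
  have hadd : Measurable fun p : PointMeasure X × X => g (p.2, p.1 + dirac p.2) :=
    hg.comp (measurable_snd.prodMk measurable_add_dirac)
  have hG := π.measurable_setLIntegral' hB
    (f := fun ν x => g (x, ν + dirac x)) hadd
  have hsplit : ∀ ν : PointMeasure X, ∀ y ∈ B,
      ∫⁻ x in B, g (x, ν + dirac y) ∂(ν + dirac y).toMeasure =
        g (y, ν + dirac y) + ∫⁻ x in B, g (x, ν + dirac y) ∂ν.toMeasure := by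
    intro ν y hy
    have hgy : Measurable fun x => g (x, ν + dirac y) := hg.comp measurable_prodMk_right
    rw [toMeasure_add, Measure.restrict_add, lintegral_add_measure, toMeasure_dirac, add_comm,
      ← lintegral_indicator hB, lintegral_dirac' _ (hgy.indicator hB), indicator_of_mem hy]
  rw [π.lintegral_configMeasure_succ hB (hcam hg)]
  have hstep : ∀ ν : PointMeasure X,
      ∫⁻ y in B, ∫⁻ x in B, g (x, ν + dirac y) ∂(ν + dirac y).toMeasure ∂π.measure ν =
        ∫⁻ y in B, g (y, ν + dirac y) ∂π.measure ν +
          ∫⁻ x in B, ∫⁻ y in B, g (x, ν + dirac y) ∂π.measure ν ∂ν.toMeasure := by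
    intro ν
    rw [setLIntegral_congr_fun hB (hsplit ν), lintegral_add_left, lintegral_lintegral_swap]
    · exact (hg.comp (measurable_snd.prodMk (measurable_const.add
        (measurable_dirac.comp measurable_fst)))).aemeasurable
    · exact hadd.comp measurable_prodMk_left
  simp_rw [hstep]
  rw [lintegral_add_left hG]
  have hg' : Measurable fun p : X × PointMeasure X =>
      ∫⁻ y in B, g (p.1, p.2 + dirac y) ∂π.measure p.2 :=
    π.measurable_setLIntegral hB (f := fun p y => g (p.1, p.2 + dirac y))
      (hg.comp ((measurable_fst.comp measurable_fst).prodMk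
        (measurable_add_dirac.comp ((measurable_snd.comp measurable_fst).prodMk measurable_snd))))
  cases m with
  | zero =>
    rw [π.lintegral_configMeasure_zero hB (hcam hg')]
    simp [toMeasure_zero]
  | succ m =>
    rw [campbell_configMeasure_succ hA1 m hg', π.lintegral_configMeasure_succ hB hG]
    -- The induction hypothesis puts the marked point before `y`; the cocycle condition moves it to
    -- the last place.
    have hsw : ∀ ν : PointMeasure X,
        ∫⁻ x in B, ∫⁻ y in B, g (x, ν + dirac x + dirac y) ∂π.measure (ν + dirac x) ∂π.measure ν =
          ∫⁻ y in B, ∫⁻ x in B, g (x, ν + dirac y + dirac x) ∂π.measure (ν + dirac y)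
            ∂π.measure ν := by
      intro ν
      have := hA1.setLIntegral hB ν (h := fun p => g (p.1, ν + dirac p.1 + dirac p.2))
        (hg.comp (measurable_fst.prodMk ((measurable_const.add
          (measurable_dirac.comp measurable_fst)).add (measurable_dirac.comp measurable_snd))))
      rw [← this]
      simp_rw [add_right_comm]
    simp_rw [hsw]
    push_cast
    ring

/-- Links the tuple form of the iterated kernels, in which local integrability is stated, to
`configMeasure`. A general `F` is needed because the induction absorbs the last point into it. -/
theorem iterLIntegral_eq_lintegral_configMeasure [BorelSpace X] (k : ℕ)
    {F : PointMeasure X → ℝ≥0∞} (hF : Measurable F) :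
    π.iterLIntegral 0 k
        (fun x => (univ.pi fun _ => B).indicator 1 x * F (∑ i, dirac (x i))) =
      ∫⁻ ν, F ν ∂π.configMeasure hB k := by
  induction k generalizing F with
  | zero =>
    rw [π.lintegral_configMeasure_zero hB hF]
    simp [iterLIntegral]
  | succ k ih =>
    rw [π.lintegral_configMeasure_succ hB hF, ← ih (π.measurable_setLIntegral' hB
      (f := fun ν x => F (ν + dirac x)) (hF.comp measurable_add_dirac)), iterLIntegral]
    congr 1
    ext x
    have hFx : Measurable fun y => F (∑ i, dirac (x i) + dirac y) :=
      hF.comp (measurable_add_dirac.comp measurable_prodMk_left)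
    rw [zero_add, ← lintegral_indicator hB, ← lintegral_const_mul _ (hFx.indicator hB)]
    refine lintegral_congr fun y => ?_
    have hmem : Fin.snoc (α := fun _ => X) x y ∈ (univ.pi fun _ : Fin (k + 1) => B) ↔
        x ∈ (univ.pi fun _ : Fin k => B) ∧ y ∈ B := by
      simp [Fin.forall_fin_succ']
    rw [Fin.sum_univ_castSucc]
    simp only [Fin.snoc_castSucc, Fin.snoc_last]
    by_cases hx : x ∈ (univ.pi fun _ : Fin k => B) <;> by_cases hy : y ∈ B <;>
      simp only [indicator, hmem, hx, hy] <;> simp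

theorem iter_zero_eq_configMeasure_univ [BorelSpace X] (k : ℕ) :
    π.iter 0 k (univ.pi fun _ => B) = π.configMeasure hB k univ := by
  have := iterLIntegral_eq_lintegral_configMeasure (π := π) hB k (F := 1) measurable_one
  simpa [iter] using this

variable (π) in
/-- The unnormalised law of the Papangelou process in `B`. -/
noncomputable def localMeasure : Measure (PointMeasure X) :=
  Measure.sum fun m => (m.factorial : ℝ≥0∞)⁻¹ • π.configMeasure hB m

theorem lintegral_localMeasure (F : PointMeasure X → ℝ≥0∞) :
    ∫⁻ ν, F ν ∂π.localMeasure hB =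
      ∑' m : ℕ, (m.factorial : ℝ≥0∞)⁻¹ * ∫⁻ ν, F ν ∂π.configMeasure hB m := by
  simp [localMeasure, lintegral_sum_measure, lintegral_smul_measure]

/-- The Papangelou identity in `B`. -/
theorem campbell_localMeasure [BorelSpace X] (hA1 : π.Cocycle)
    {g : X × PointMeasure X → ℝ≥0∞} (hg : Measurable g) :
    ∫⁻ ν, ∫⁻ x in B, g (x, ν) ∂ν.toMeasure ∂π.localMeasure hB =
      ∫⁻ ν, ∫⁻ x in B, g (x, ν + dirac x) ∂π.measure ν ∂π.localMeasure hB := by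
  have hcam : Measurable fun ν : PointMeasure X => ∫⁻ x in B, g (x, ν) ∂ν.toMeasure :=
    Measurable.lintegral_kernel_prod_right' (κ := (PointMeasure.kernel X).restrict hB)
      (hg.comp measurable_swap)
  -- The term `m = 0` is the empty configuration, with no point to mark. After the index shift, the
  -- factor `m + 1` turns `1/(m+1)!` into `1/m!`.
  rw [lintegral_localMeasure, lintegral_localMeasure, tsum_eq_zero_add' ENNReal.summable,
    π.lintegral_configMeasure_zero hB hcam, toMeasure_zero]
  simp_rw [campbell_configMeasure_succ hB hA1 _ hg]
  simp only [Measure.restrict_zero, lintegral_zero_measure, mul_zero, zero_add]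
  refine tsum_congr fun m => ?_
  rw [← mul_assoc]
  congr 1
  rw [Nat.factorial_succ, Nat.cast_mul, Nat.cast_add_one, ENNReal.mul_inv
    (Or.inr (ENNReal.natCast_ne_top _)) (Or.inl (by finiteness)), mul_comm, ← mul_assoc,
    ENNReal.mul_inv_cancel (by positivity) (by finiteness), one_mul]

theorem localMeasure_univ_lt_top [BorelSpace X] (hA3 : π.LocallyIntegrable)
    (hBb : Bornology.IsBounded B) : π.localMeasure hB univ < ∞ := by
  have h := (hA3 0 B hB hBb).2
  rw [restrict_zero] at h
  rw [← lintegral_one, lintegral_localMeasure]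
  simpa [iter_zero_eq_configMeasure_univ hB, ENNReal.div_eq_inv_mul] using h

/-- The empty configuration alone contributes mass 1. -/
theorem localMeasure_univ_ne_zero [BorelSpace X] : π.localMeasure hB univ ≠ 0 := by
  rw [← lintegral_one, lintegral_localMeasure]
  refine (ENNReal.tsum_eq_zero.not.2 fun h => ?_)
  have h0 := h 0
  rw [π.lintegral_configMeasure_zero hB measurable_const] at h0
  simp at h0

end RadonKernel

open RadonKernel

variable {π : RadonKernel X}

/-! ### Uniqueness -/

theorem PointMeasure.measurable_of_restrict {U : ℕ → Set X} (hU : ∀ n, MeasurableSet (U n))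
    (hmono : Monotone U) (hcov : ⋃ n, U n = univ) {Ω : Type*} [MeasurableSpace Ω]
    {f : Ω → PointMeasure X} (hf : ∀ n, Measurable fun ω => (f ω).restrict (U n) (hU n)) :
    Measurable f := by
  refine measurable_of_forall fun B hB => ?_
  have hsup : (fun ω => (f ω).toMeasure B) =
      fun ω => ⨆ n, ((f ω).restrict (U n) (hU n)).toMeasure B := by
    ext ω
    have hm : Monotone fun n => B ∩ U n := fun m n hmn => inter_subset_inter_right _ (hmono hmn)
    simp_rw [PointMeasure.restrict_apply _ _ hB]
    rw [← hm.measure_iUnion, ← inter_iUnion, hcov, inter_univ]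
  rw [hsup]
  exact Measurable.iSup fun n => (measurable_toMeasure_apply hB).comp (hf n)

/-- The law of a point process is determined by the laws of its restrictions to an exhaustion. -/
theorem ext_of_map_restrict_eq {U : ℕ → Set X} (hU : ∀ n, MeasurableSet (U n)) (hmono : Monotone U)
    (hcov : ⋃ n, U n = univ) {P Q : Measure (PointMeasure X)} [IsProbabilityMeasure P]
    [IsProbabilityMeasure Q]
    (h : ∀ n, P.map (fun μ => μ.restrict (U n) (hU n)) = Q.map fun μ => μ.restrict (U n) (hU n)) :
    P = Q := by
  let r : ℕ → PointMeasure X → PointMeasure X := fun n μ => μ.restrict (U n) (hU n)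
  have hr : ∀ n, Measurable (r n) := fun n => measurable_restrict (hU n)
  -- Events visible in some `U n`. They form a π-system since `r m` factors through `r n` for `m ≤
  -- n`, and they generate because the identity is measurable from `generateFrom C`.
  let C : Set (Set (PointMeasure X)) := {s | ∃ n A, MeasurableSet A ∧ r n ⁻¹' A = s}
  have hrr : ∀ {m n : ℕ}, m ≤ n → ∀ μ, r m (r n μ) = r m μ := by
    intro m n hmn μ
    ext A hA
    rw [PointMeasure.restrict_apply _ _ hA, PointMeasure.restrict_apply _ _ (hA.inter (hU m)),
      PointMeasure.restrict_apply _ _ hA, inter_assoc, inter_eq_self_of_subset_left (hmono hmn)]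
  have hgen : (inferInstance : MeasurableSpace (PointMeasure X)) =
      MeasurableSpace.generateFrom C := by
    refine le_antisymm ?_ (MeasurableSpace.generateFrom_le ?_)
    · have hid : @Measurable _ _ (MeasurableSpace.generateFrom C) _ (id : PointMeasure X → _) :=
        @PointMeasure.measurable_of_restrict X _ _ U hU hmono hcov _
          (MeasurableSpace.generateFrom C) id
          fun n s hs => MeasurableSpace.measurableSet_generateFrom ⟨n, s, hs, rfl⟩
      intro s hs
      exact hid hs
    · rintro _ ⟨n, A, hA, rfl⟩
      exact hr n hA
  refine ext_of_generate_finite C hgen ?_ ?_ (by rw [measure_univ, measure_univ])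
  · rintro _ ⟨m, A, hA, rfl⟩ _ ⟨n, A', hA', rfl⟩ -
    refine ⟨max m n, r m ⁻¹' A ∩ r n ⁻¹' A', (hr m hA).inter (hr n hA'), ?_⟩
    ext μ
    simp only [mem_preimage, mem_inter_iff, hrr (le_max_left m n), hrr (le_max_right m n)]
  · rintro _ ⟨n, A, hA, rfl⟩
    rw [← Measure.map_apply (hr n) hA, ← Measure.map_apply (hr n) hA]
    exact congrArg (fun ρ => ρ A) (h n)

/-- Test the Papangelou identity with `1_B(x) 1{μ(B) = m+1} F(μ_B)`. The left side counts the `m +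
1` points of `B`; the right side lives on `{μ(B) = m}` and adds a point to `μ_B`. Iterating empties
`B`. -/
theorem IsPapangelouProcess.factorial_mul_setLIntegral [SecondCountableTopology X] [BorelSpace X]
    (hA2 : π.WeakSufficiency) (hA7 : π.VaguelyContinuous)
    {P : ProbabilityMeasure (PointMeasure X)} (hP : IsPapangelouProcess π P)
    {B : Set X} (hB : MeasurableSet B) (hBb : Bornology.IsBounded B) (m : ℕ)
    {F : PointMeasure X → ℝ≥0∞} (hF : Measurable F) :
    m.factorial * ∫⁻ μ in {μ : PointMeasure X | μ.toMeasure B = m}, F (μ.restrict B hB) ∂(P : Measure (PointMeasure X)) =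
      (P : Measure (PointMeasure X)) {μ : PointMeasure X | μ.toMeasure B = 0} * ∫⁻ ν, F ν ∂π.configMeasure hB m := by
  have hN : ∀ m : ℕ, MeasurableSet {μ : PointMeasure X | μ.toMeasure B = m} := fun m =>
    measurable_toMeasure_apply hB (measurableSet_singleton (m : ℝ≥0∞))
  induction m generalizing F with
  | zero =>
    have h0 : ∀ μ ∈ {μ : PointMeasure X | μ.toMeasure B = (0 : ℕ)}, F (μ.restrict B hB) = F 0 := by
      intro μ hμ
      congr 1
      ext A hA
      rw [PointMeasure.restrict_apply _ _ hA]
      exact measure_mono_null inter_subset_right (by simpa using hμ)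
    rw [setLIntegral_congr_fun (hN 0) h0, setLIntegral_const,
      π.lintegral_configMeasure_zero hB hF]
    simp [mul_comm]
  | succ m ih =>
    have hF' : Measurable fun ν => ∫⁻ x in B, F (ν + dirac x) ∂π.measure ν :=
      π.measurable_setLIntegral' hB (f := fun ν x => F (ν + dirac x))
        (hF.comp measurable_add_dirac)
    rw [π.lintegral_configMeasure_succ hB hF, ← ih hF', Nat.factorial_succ, mul_comm (m + 1),
      Nat.cast_mul, mul_assoc]
    congr 1
    have hFB : Measurable fun μ : PointMeasure X => F (μ.restrict B hB) :=
      hF.comp (measurable_restrict hB)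
    have key := hP (fun p => B.indicator 1 p.1 *
      {μ : PointMeasure X | μ.toMeasure B = (m + 1 : ℕ)}.indicator
        (fun μ => F (μ.restrict B hB)) p.2)
      (((measurable_one.indicator hB).comp measurable_fst).mul
        ((hFB.indicator (hN (m + 1))).comp measurable_snd))
    have hl : ∀ μ : PointMeasure X, ∫⁻ x, B.indicator 1 x *
        {μ : PointMeasure X | μ.toMeasure B = (m + 1 : ℕ)}.indicator
          (fun μ => F (μ.restrict B hB)) μ ∂μ.toMeasure =
        {μ : PointMeasure X | μ.toMeasure B = (m + 1 : ℕ)}.indicator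
          (fun μ => (m + 1 : ℕ) * F (μ.restrict B hB)) μ := by
      intro μ
      rw [lintegral_mul_const _ (measurable_one.indicator hB), lintegral_indicator_one hB]
      by_cases hμ : μ.toMeasure B = (m + 1 : ℕ)
      · rw [indicator_of_mem (show μ ∈ {μ : PointMeasure X | μ.toMeasure B = (m + 1 : ℕ)} from hμ),
          indicator_of_mem (show μ ∈ {μ : PointMeasure X | μ.toMeasure B = (m + 1 : ℕ)} from hμ), hμ]
      · rw [indicator_of_notMem (show μ ∉ {μ : PointMeasure X | μ.toMeasure B = (m + 1 : ℕ)} from hμ),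
          indicator_of_notMem (show μ ∉ {μ : PointMeasure X | μ.toMeasure B = (m + 1 : ℕ)} from hμ),
          mul_zero]
    have hr : ∀ μ : PointMeasure X, ∫⁻ x, B.indicator 1 x *
        {μ : PointMeasure X | μ.toMeasure B = (m + 1 : ℕ)}.indicator
          (fun μ => F (μ.restrict B hB)) (μ + dirac x) ∂π.measure μ =
        {μ : PointMeasure X | μ.toMeasure B = (m : ℕ)}.indicator
          (fun μ => ∫⁻ x in B, F (μ.restrict B hB + dirac x) ∂π.measure (μ.restrict B hB)) μ := by
      intro μ
      have hpt : ∀ x, B.indicator 1 x *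
          {μ : PointMeasure X | μ.toMeasure B = (m + 1 : ℕ)}.indicator
            (fun μ => F (μ.restrict B hB)) (μ + dirac x) =
          B.indicator (fun x => {μ : PointMeasure X | μ.toMeasure B = (m : ℕ)}.indicator
            (fun μ => F (μ.restrict B hB + dirac x)) μ) x := by
        intro x
        by_cases hx : x ∈ B
        · have hmem : (μ + dirac x).toMeasure B = (m + 1 : ℕ) ↔ μ.toMeasure B = m := by
            rw [toMeasure_add, Measure.add_apply, toMeasure_dirac, Measure.dirac_apply' _ hB,
              indicator_of_mem hx]
            push_cast
            exact ENNReal.add_left_inj ENNReal.one_ne_top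
          rw [indicator_of_mem hx, indicator_of_mem hx, Pi.one_apply, one_mul]
          simp only [indicator, mem_ofPred_eq, hmem, restrict_add, restrict_dirac_of_mem hB hx]
        · simp [hx]
      simp_rw [hpt]
      rw [lintegral_indicator hB]
      by_cases hμ : μ.toMeasure B = (m : ℕ)
      · simp only [indicator, mem_ofPred_eq, hμ, if_true]
        -- Locality replaces `π(μ, ·)` by `π(μ_B, ·)`, so the integrand is again a function of `μ_B`
        -- and the induction closes.
        rw [restrict_measure_restrict hA2 hA7 μ hB hBb]
      · simp [indicator, hμ]
    rw [campbell] at key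
    simp only [hl, hr] at key
    rw [lintegral_indicator (hN _), lintegral_indicator (hN _), lintegral_const_mul _ hFB] at key
    exact key

/-- The law of a Papangelou process in a bounded set is the normalised local measure. -/
theorem IsPapangelouProcess.map_restrict [SecondCountableTopology X] [BorelSpace X]
    (hA2 : π.WeakSufficiency) (hA7 : π.VaguelyContinuous)
    {P : ProbabilityMeasure (PointMeasure X)} (hP : IsPapangelouProcess π P)
    {B : Set X} (hB : MeasurableSet B) (hBb : Bornology.IsBounded B) :
    (P : Measure (PointMeasure X)).map (fun μ => μ.restrict B hB) =
      (π.localMeasure hB univ)⁻¹ • π.localMeasure hB := by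
  have hN : ∀ m : ℕ, MeasurableSet {μ : PointMeasure X | μ.toMeasure B = m} := fun m =>
    measurable_toMeasure_apply hB (measurableSet_singleton (m : ℝ≥0∞))
  have hcov : ⋃ m : ℕ, {μ : PointMeasure X | μ.toMeasure B = m} = univ := by
    ext μ
    simpa using μ.exists_nat_eq hB (μ.1.2 B hB hBb).ne
  have hdisj : Pairwise (Function.onFun Disjoint
      fun m : ℕ => {μ : PointMeasure X | μ.toMeasure B = m}) := by
    intro m n hmn
    refine disjoint_left.2 fun μ (h1 : μ.toMeasure B = m) (h2 : μ.toMeasure B = n) => hmn ?_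
    exact_mod_cast h1.symm.trans h2
  have hint : ∀ F : PointMeasure X → ℝ≥0∞, Measurable F →
      ∫⁻ μ, F (μ.restrict B hB) ∂(P : Measure (PointMeasure X)) =
        (P : Measure (PointMeasure X)) {μ : PointMeasure X | μ.toMeasure B = 0} * ∫⁻ ν, F ν ∂π.localMeasure hB := by
    intro F hF
    rw [← setLIntegral_univ, ← hcov, lintegral_iUnion hN hdisj, lintegral_localMeasure,
      ← ENNReal.tsum_mul_left]
    refine tsum_congr fun m => ?_
    rw [mul_left_comm, ← hP.factorial_mul_setLIntegral hA2 hA7 hB hBb m hF, ← mul_assoc,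
      ENNReal.inv_mul_cancel (by exact_mod_cast m.factorial_ne_zero) (by finiteness), one_mul]
  -- Testing with 1 identifies `P(μ(B) = 0)` as the inverse of the total mass of the local measure.
  have hone := hint 1 measurable_one
  simp only [Pi.one_apply, lintegral_one, measure_univ] at hone
  have hc := ENNReal.eq_inv_of_mul_eq_one_left hone.symm
  ext s hs
  rw [← lintegral_indicator_one hs, lintegral_map (measurable_one.indicator hs)
    (measurable_restrict hB), hint _ (measurable_one.indicator hs), hc,
    lintegral_indicator_one hs]
  rfl

/-- There is at most one Papangelou process. -/
theorem IsPapangelouProcess.unique [SecondCountableTopology X] [BorelSpace X]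
    (hA2 : π.WeakSufficiency) (hA7 : π.VaguelyContinuous)
    {P Q : ProbabilityMeasure (PointMeasure X)} (hP : IsPapangelouProcess π P)
    (hQ : IsPapangelouProcess π Q) : P = Q := by
  obtain ⟨U, hUo, hUb, hmono, hcov, -⟩ := exists_bounded_exhaustion X
  have h : (P : Measure (PointMeasure X)) = Q :=
    ext_of_map_restrict_eq (fun n => (hUo n).measurableSet) hmono hcov fun n =>
      (hP.map_restrict hA2 hA7 (hUo n).measurableSet (hUb n)).trans
        (hQ.map_restrict hA2 hA7 (hUo n).measurableSet (hUb n)).symm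
  exact Subtype.ext h

/-! ### Existence by gluing independent local processes -/

/-- A product measure is invariant under independent resampling of one coordinate. -/
theorem map_update_prod_infinitePi {ι : Type*} [DecidableEq ι] {Y : Type*} [MeasurableSpace Y]
    (Q : ι → Measure Y) [∀ i, IsProbabilityMeasure (Q i)] (n : ι) :
    ((Measure.infinitePi Q).prod (Q n)).map (fun p => Function.update p.1 n p.2) =
      Measure.infinitePi Q := by
  have hm : Measurable fun p : (ι → Y) × Y => Function.update p.1 n p.2 := measurable_update'
  refine Measure.eq_infinitePi Q fun s t ht => ?_
  have hset : MeasurableSet (Set.pi (s : Set ι) t) :=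
    MeasurableSet.pi s.countable_toSet fun i _ => ht i
  rw [Measure.map_apply hm hset]
  by_cases hn : n ∈ s
  · have hpre : (fun p : (ι → Y) × Y => Function.update p.1 n p.2) ⁻¹' Set.pi (s : Set ι) t =
        (Set.pi ((s.erase n : Finset ι) : Set ι) t) ×ˢ t n := by
      ext ⟨ω, a⟩
      simp only [mem_preimage, Set.mem_pi, mem_prod, Finset.mem_coe, Finset.mem_erase]
      refine ⟨fun h => ⟨fun i hi => by simpa [hi.1] using h i hi.2, by simpa using h n hn⟩,
        fun h i hi => ?_⟩
      by_cases hin : i = n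
      · subst hin
        simpa using h.2
      · simpa [hin] using h.1 i ⟨hin, hi⟩
    rw [hpre, Measure.prod_prod, Measure.infinitePi_pi Q fun i _ => ht i,
      Finset.prod_erase_mul _ _ hn]
  · have hpre : (fun p : (ι → Y) × Y => Function.update p.1 n p.2) ⁻¹' Set.pi (s : Set ι) t =
        (Set.pi (s : Set ι) t) ×ˢ univ := by
      ext ⟨ω, a⟩
      simp only [mem_preimage, Set.mem_pi, mem_prod, mem_univ, and_true]
      refine forall₂_congr fun i hi => ?_
      rw [Function.update_of_ne (ne_of_mem_of_not_mem hi hn)]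
    rw [hpre, Measure.prod_prod, measure_univ, mul_one, Measure.infinitePi_pi Q fun i _ => ht i]

theorem exists_enat_eq_tsum {a : ℕ → ℝ≥0∞} (ha : ∀ i, ∃ n : ℕ∞, a i = (n : ℝ≥0∞)) :
    ∃ n : ℕ∞, ∑' i, a i = (n : ℝ≥0∞) := by
  by_cases htop : ∑' i, a i = ∞
  · exact ⟨⊤, by simp [htop]⟩
  choose N hN using ha
  -- A finite sum has only finitely many terms at least 1, and an integer term below 1 is zero.
  have hfin : {i | 1 ≤ a i}.Finite := ENNReal.finite_const_le_of_tsum_ne_top htop one_ne_zero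
  refine ⟨∑ i ∈ hfin.toFinset, N i, ?_⟩
  rw [tsum_eq_sum (s := hfin.toFinset)]
  · exact (Finset.sum_congr rfl fun i _ => hN i).trans
      (map_sum ENat.toENNRealRingHom N hfin.toFinset).symm
  · intro i hi
    have hlt : a i < 1 := by simpa using hi
    rw [hN i] at hlt ⊢
    have h1 : N i < 1 := by exact_mod_cast hlt
    simp [Order.lt_one_iff.1 h1]

/-- The point measure that coincides with `ω n` on `B n`, for disjoint sets `B n` of which only
finitely many meet any given bounded set. -/
noncomputable def PointMeasure.glue {B : ℕ → Set X} (hB : ∀ n, MeasurableSet (B n))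
    (hloc : ∀ A, Bornology.IsBounded A → ∃ N, ∀ n, N ≤ n → Disjoint A (B n))
    (hbd : ∀ n, Bornology.IsBounded (B n)) (ω : ℕ → PointMeasure X) : PointMeasure X :=
  ⟨⟨Measure.sum fun n => (ω n).toMeasure.restrict (B n), by
    intro A hA hAb
    obtain ⟨N, hN⟩ := hloc A hAb
    rw [Measure.sum_apply _ hA, tsum_eq_sum (s := Finset.range N)]
    · refine ENNReal.sum_lt_top.2 fun n _ => ?_
      rw [Measure.restrict_apply hA]
      exact (measure_mono inter_subset_right).trans_lt ((ω n).1.2 _ (hB n) (hbd n))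
    · intro n hn
      rw [Measure.restrict_apply hA, (hN n (by simpa using hn)).inter_eq, measure_empty]⟩, by
    intro A hA
    change ∃ n : ℕ∞, Measure.sum (fun n => (ω n).toMeasure.restrict (B n)) A = n
    rw [Measure.sum_apply _ hA]
    exact exists_enat_eq_tsum fun i => ((ω i).restrict (B i) (hB i)).2 A hA⟩

section Glue

variable {B : ℕ → Set X} (hB : ∀ n, MeasurableSet (B n))
  (hloc : ∀ A, Bornology.IsBounded A → ∃ N, ∀ n, N ≤ n → Disjoint A (B n))
  (hbd : ∀ n, Bornology.IsBounded (B n))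

theorem PointMeasure.glue_apply (ω : ℕ → PointMeasure X) {A : Set X} (hA : MeasurableSet A) :
    (glue hB hloc hbd ω).toMeasure A = ∑' n, (ω n).toMeasure (A ∩ B n) := by
  change Measure.sum (fun n => (ω n).toMeasure.restrict (B n)) A = _
  simp_rw [Measure.sum_apply _ hA, Measure.restrict_apply hA]

theorem PointMeasure.measurable_glue : Measurable (glue hB hloc hbd) := by
  refine measurable_of_forall fun A hA => ?_
  simp_rw [glue_apply hB hloc hbd _ hA]
  exact Measurable.tsum fun n =>
    (measurable_toMeasure_apply (hA.inter (hB n))).comp (measurable_pi_apply n)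

/-- Redrawing one coordinate changes the glued configuration only in its own cell; the rest acts as
a frozen exterior. -/
theorem PointMeasure.glue_update (hdisj : Pairwise (Function.onFun Disjoint B))
    (ω : ℕ → PointMeasure X) (n : ℕ) (a : PointMeasure X) :
    glue hB hloc hbd (Function.update ω n a) =
      a.restrict (B n) (hB n) + (glue hB hloc hbd ω).restrict (B n)ᶜ (hB n).compl := by
  rw [(glue hB hloc hbd (Function.update ω n a)).restrict_add_restrict_compl (hB n)]
  congr 1
  · ext A hA
    rw [PointMeasure.restrict_apply _ _ hA, PointMeasure.restrict_apply _ _ hA,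
      glue_apply _ _ _ _ (hA.inter (hB n)), tsum_eq_single n]
    · rw [Function.update_self, inter_assoc, inter_self]
    · intro k hk
      rw [inter_assoc, (hdisj hk.symm).inter_eq, inter_empty, measure_empty]
  · ext A hA
    rw [PointMeasure.restrict_apply _ _ hA, PointMeasure.restrict_apply _ _ hA,
      glue_apply _ _ _ _ (hA.inter (hB n).compl), glue_apply _ _ _ _ (hA.inter (hB n).compl)]
    refine tsum_congr fun k => ?_
    by_cases hk : k = n
    · subst hk
      rw [inter_assoc, compl_inter_self, inter_empty, measure_empty, measure_empty]
    · rw [Function.update_of_ne hk]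

end Glue

/-- The Papangelou identity in `B`, with an arbitrary fixed configuration outside `B`. -/
theorem campbell_localMeasure_add [SecondCountableTopology X] [BorelSpace X] (hA1 : π.Cocycle)
    (hA2 : π.WeakSufficiency) (hA7 : π.VaguelyContinuous) {B : Set X} (hB : MeasurableSet B)
    (hBb : Bornology.IsBounded B) {h : X × PointMeasure X → ℝ≥0∞} (hh : Measurable h)
    (ρ : PointMeasure X) :
    ∫⁻ ν, ∫⁻ x in B, h (x, ν.restrict B hB + ρ.restrict Bᶜ hB.compl)
        ∂(ν.restrict B hB + ρ.restrict Bᶜ hB.compl).toMeasure ∂π.localMeasure hB =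
      ∫⁻ ν, ∫⁻ x in B, h (x, ν.restrict B hB + ρ.restrict Bᶜ hB.compl + dirac x)
        ∂π.measure (ν.restrict B hB + ρ.restrict Bᶜ hB.compl) ∂π.localMeasure hB := by
  have hres : ∀ ν : PointMeasure X,
      (ν.restrict B hB + ρ.restrict Bᶜ hB.compl).restrict B hB = ν.restrict B hB := by
    intro ν
    ext A hA
    rw [PointMeasure.restrict_apply _ _ hA, toMeasure_add, Measure.add_apply,
      PointMeasure.restrict_apply _ _ (hA.inter hB), PointMeasure.restrict_apply _ _ (hA.inter hB),
      PointMeasure.restrict_apply _ _ hA, inter_assoc, inter_self, inter_assoc, inter_compl_self,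
      inter_empty, measure_empty, add_zero]
  have hl : ∀ ν : PointMeasure X,
      (ν.restrict B hB + ρ.restrict Bᶜ hB.compl).toMeasure.restrict B = ν.toMeasure.restrict B :=
    fun ν => congrArg PointMeasure.toMeasure (hres ν)
  -- By locality the exterior `ρ` does not influence the kernel inside `B`, so it enters only as a
  -- parameter of the integrand.
  have hr : ∀ ν : PointMeasure X,
      (π.measure (ν.restrict B hB + ρ.restrict Bᶜ hB.compl)).restrict B =
        (π.measure ν).restrict B := by
    intro ν
    rw [← restrict_measure_restrict hA2 hA7 _ hB hBb, hres,
      restrict_measure_restrict hA2 hA7 _ hB hBb]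
  simp_rw [hl, hr]
  have hg : Measurable fun p : X × PointMeasure X =>
      h (p.1, p.2.restrict B hB + ρ.restrict Bᶜ hB.compl) :=
    hh.comp (measurable_fst.prodMk
      (((measurable_restrict hB).comp measurable_snd).add measurable_const))
  rw [campbell_localMeasure hB hA1 hg]
  refine lintegral_congr fun ν => setLIntegral_congr_fun hB fun x hx => ?_
  dsimp only
  rw [restrict_add, restrict_dirac_of_mem hB hx, add_right_comm]

/-- There is a Papangelou process. -/
theorem exists_isPapangelouProcess [SecondCountableTopology X] [BorelSpace X] (hA1 : π.Cocycle)
    (hA2 : π.WeakSufficiency) (hA3 : π.LocallyIntegrable) (hA7 : π.VaguelyContinuous) :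
    ∃ P : ProbabilityMeasure (PointMeasure X), IsPapangelouProcess π P := by
  obtain ⟨U, hUo, hUb, hmono, hcovU, hex⟩ := exists_bounded_exhaustion X
  let B : ℕ → Set X := disjointed U
  have hB : ∀ n, MeasurableSet (B n) := fun n =>
    MeasurableSet.disjointed (fun n => (hUo n).measurableSet) n
  have hbd : ∀ n, Bornology.IsBounded (B n) := fun n => (hUb n).subset (disjointed_subset U n)
  have hdisj : Pairwise (Function.onFun Disjoint B) := disjoint_disjointed U
  have hcov : ⋃ n, B n = univ := by rw [iUnion_disjointed, hcovU]
  have hloc : ∀ A, Bornology.IsBounded A → ∃ N, ∀ n, N ≤ n → Disjoint A (B n) := by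
    intro A hA
    obtain ⟨N, hN⟩ := hex A hA
    refine ⟨N + 1, fun n hn => disjoint_left.2 fun x hxA hxB => ?_⟩
    rw [show B n = _ from disjointed_eq_inter_compl U n] at hxB
    exact mem_iInter₂.1 hxB.2 N hn (hN hxA)
  let Q : ℕ → Measure (PointMeasure X) := fun n =>
    (π.localMeasure (hB n) univ)⁻¹ • π.localMeasure (hB n)
  have hQ : ∀ n, IsProbabilityMeasure (Q n) := by
    intro n
    refine ⟨?_⟩
    rw [Measure.smul_apply, smul_eq_mul]
    exact ENNReal.inv_mul_cancel (localMeasure_univ_ne_zero (hB n))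
      (localMeasure_univ_lt_top (hB n) hA3 (hbd n)).ne
  let T : (ℕ → PointMeasure X) → PointMeasure X := glue hB hloc hbd
  have hT : Measurable T := measurable_glue hB hloc hbd
  let IP : Measure (ℕ → PointMeasure X) := Measure.infinitePi Q
  have hP : IsProbabilityMeasure (IP.map T) := Measure.isProbabilityMeasure_map hT.aemeasurable
  refine ⟨⟨IP.map T, hP⟩, fun h hh => ?_⟩
  change ∫⁻ μ, ∫⁻ x, h (x, μ) ∂μ.toMeasure ∂(IP.map T) =
    ∫⁻ μ, ∫⁻ x, h (x, μ + dirac x) ∂(π.measure μ) ∂(IP.map T)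
  have hΦ : ∀ n, Measurable fun μ : PointMeasure X => ∫⁻ x in B n, h (x, μ) ∂μ.toMeasure := fun n =>
    Measurable.lintegral_kernel_prod_right' (κ := (PointMeasure.kernel X).restrict (hB n))
      (hh.comp measurable_swap)
  have hΨ : ∀ n, Measurable fun μ : PointMeasure X =>
      ∫⁻ x in B n, h (x, μ + dirac x) ∂π.measure μ := fun n =>
    π.measurable_setLIntegral' (hB n) (f := fun μ x => h (x, μ + dirac x))
      (hh.comp (measurable_snd.prodMk measurable_add_dirac))
  have hdecomp : ∀ (ν : Measure X) (f : X → ℝ≥0∞), ∫⁻ x, f x ∂ν = ∑' n, ∫⁻ x in B n, f x ∂ν := by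
    intro ν f
    rw [← lintegral_iUnion hB hdisj, hcov, setLIntegral_univ]
  -- Resampling the `n`-th coordinate preserves the product law; this exposes an integral against
  -- the local law of cell `n`, with the exterior given by `ω`.
  have hresample : ∀ (n : ℕ) {F : PointMeasure X → ℝ≥0∞}, Measurable F →
      ∫⁻ μ, F μ ∂(IP.map T) = ∫⁻ ω, (π.localMeasure (hB n) univ)⁻¹ *
        ∫⁻ ν, F (ν.restrict (B n) (hB n) + (T ω).restrict (B n)ᶜ (hB n).compl)
          ∂π.localMeasure (hB n) ∂IP := by
    intro n F hF
    have hup : Measurable fun p : (ℕ → PointMeasure X) × PointMeasure X =>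
        Function.update p.1 n p.2 := measurable_update'
    rw [lintegral_map hF hT]
    change ∫⁻ ω, F (T ω) ∂(Measure.infinitePi Q) = _
    rw [← map_update_prod_infinitePi Q n, lintegral_map (f := fun ω => F (T ω)) (hF.comp hT) hup,
      lintegral_prod (fun p => F (T (Function.update p.1 n p.2)))
        ((hF.comp hT).comp hup).aemeasurable]
    refine lintegral_congr fun ω => ?_
    rw [lintegral_smul_measure, smul_eq_mul]
    congr 1
    exact lintegral_congr fun ν => congrArg F (glue_update hB hloc hbd hdisj ω n ν)
  -- Both sides are split according to the cell containing `x`, and the identity is checked cell by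
  -- cell.
  rw [lintegral_congr fun μ => hdecomp μ.toMeasure fun x => h (x, μ),
    lintegral_congr fun μ => hdecomp (π.measure μ) fun x => h (x, μ + dirac x),
    lintegral_tsum fun n => (hΦ n).aemeasurable,
    lintegral_tsum fun n => (hΨ n).aemeasurable]
  refine tsum_congr fun n => ?_
  rw [hresample n (hΦ n), hresample n (hΨ n)]
  refine lintegral_congr fun ω => ?_
  rw [campbell_localMeasure_add hA1 hA2 hA7 (hB n) (hbd n) hh]

end Papangelou

theorem mainTheorem5 {X : Type*} [MetricSpace X] [CompleteSpace X]
    [TopologicalSpace.SeparableSpace X] [MeasurableSpace X] [BorelSpace X]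
    (π : Papangelou.RadonKernel X)
    (hA1 : π.Cocycle) (hA2 : π.WeakSufficiency) (hA3 : π.LocallyIntegrable)
    (hA7 : π.VaguelyContinuous) :
    ∃! P : ProbabilityMeasure (Papangelou.PointMeasure X),
      Papangelou.IsPapangelouProcess π P := by
  have : SecondCountableTopology X := UniformSpace.secondCountable_of_separable X
  obtain ⟨P, hP⟩ := Papangelou.exists_isPapangelouProcess hA1 hA2 hA3 hA7
  exact ⟨P, hP, fun Q hQ => hQ.unique hA2 hA7 hP⟩
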